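/- Conventions. A Cantor space is a non-empty compact totally disconnected metrizable space without isolated points. Let $G$ be a group and $\Phi\colon G\to \mathrm{Homeo}(X)$ an action on a Cantor space $X$ with a compatible metric $d_X$; write $(X,G,\Phi)$. * The action is minimal if every orbit is dense. It is equicontinuous if for every $\varepsilon>0$ there is $\delta>0$ such that $d_X(x,y)<\delta$ implies $d_X(\Phi(g)x,\Phi(g)y)<\varepsilon$ for all $g\in G$. * The action is locally quasi-analytic if there is $\varepsilon>0$ such that for every non-empty open $U\subset X$ with $\mathrm{diam}(U)<\varepsilon$, every non-empty open $V\subset U$ and all $g_1,g_2\in G$: if $\Phi(g_1)|_V=\Phi(g_2)|_V$, then $\Phi(g_1)|_U=\Phi(g_2)|_U$. * A subset $U\subset X$ is adapted if it is non-empty and clopen and, for all $g\in G$, $\Phi(g)(U)\cap U\neq\emptyset$ implies $\Phi(g)(U)=U$. Then $G_U=\{g\in G : \Phi(g)(U)=U\}$ is its stabilizer, $\Phi_U\colon G_U\to\mathrm{Homeo}(U)$ is the restricted action, and $\mathcal H^{\Phi}_U=\Phi_U(G_U)\subset \mathrm{Homeo}(U)$ is the restricted holonomy group. * The topological full group $[[X,G,\Phi]]$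 is the group of all homeomorphisms $\phi$ of $X$ such that every $x\in X$ has a clopen neighbourhood $W$ and an element $g\in G$ with $\phi|_W=\Phi(g)|_W$; the group $[[U,G_U,\Phi_U]]\subset\mathrm{Homeo}(U)$ is defined in the same way from the restricted action. * The full groups of $(X,G,\Phi)$ and $(Y,H,\Psi)$ are virtually isomorphic if there are adapted sets $U\subset X$ and $V\subset Y$ such that $[[U,G_U,\Phi_U]]$ and $[[V,H_V,\Psi_V]]$ are isomorphic as abstract groups. * The actions are return equivalent if there are adapted sets $U\subset X$ and $V\subset Y$ and a homeomorphism $h\colon U\to V$ such that $\phi\mapsto h\circ\phi\circ h^{-1}$ maps $\mathcal H^{\Phi}_U$ isomorphically onto $\mathcal H^{\Psi}_V$. Theorem. Let $G$ and $H$ be finitely generated groups, and let $(X,G,\Phi)$ and $(Y,H,\Psi)$ be minimal equicontinuous actions on Cantor spaces which are locally quasi-analytic. If their topological full groups are virtually isomorphic, then the actions $(X,G,\Phi)$ and $(Y,H,\Psi)$ are return equivalent. -/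

import Mathlib

/-- A Cantor space: a non-empty, compact, metrizable, totally disconnected topological space
without isolated points. -/
structure IsCantorSpace (X : Type*) [TopologicalSpace X] : Prop where
  nonempty : Nonempty X
  compact : CompactSpace X
  metrizable : TopologicalSpace.MetrizableSpace X
  totallyDisconnected : TotallyDisconnectedSpace X
  perfect : PerfectSpace X

/-! An action of a (discrete) group `G` on a space `X` by homeomorphisms is a homomorphism
`Φ : G →* (X ≃ₜ X)`. -/

namespace CantorAction

section Topological

variable {G H X Y : Type*} [Group G] [Group H] [TopologicalSpace X] [TopologicalSpace Y]

/-- Every orbit is dense. -/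
def IsMinimal (Φ : G →* (X ≃ₜ X)) : Prop :=
  ∀ x : X, Dense (Set.range fun g : G => Φ g x)

/-- `U` is adapted to the action: it is non-empty and clopen, and every translate of `U` that
meets `U` equals `U`. -/
def IsAdapted (Φ : G →* (X ≃ₜ X)) (U : Set X) : Prop :=
  U.Nonempty ∧ IsClopen U ∧ ∀ g : G, (Φ g '' U ∩ U).Nonempty → Φ g '' U = U

/-- The stabilizer `G_U` of a subset `U`. For an adapted set see `mem_stab_iff`. -/
def stab (Φ : G →* (X ≃ₜ X)) (U : Set X) : Subgroup G where
  carrier := {g | Φ g '' U = U}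
  one_mem' := by
    show (Φ 1) '' U = U
    rw [map_one]
    exact Set.image_id U
  mul_mem' := by
    intro a b ha hb
    show (Φ (a * b)) '' U = U
    have ha' : Φ a '' U = U := ha
    have hb' : Φ b '' U = U := hb
    have h : (Φ (a * b) : X → X) = Φ a ∘ Φ b := by rw [map_mul]; rfl
    rw [h, Set.image_comp, hb', ha']
  inv_mem' := by
    intro a ha
    show (Φ a⁻¹) '' U = U
    have ha' : Φ a '' U = U := ha
    have h : (Φ a⁻¹ : X → X) ∘ Φ a = id := by
      funext x
      show (Φ a⁻¹ * Φ a) x = x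
      rw [← map_mul, inv_mul_cancel, map_one]
      rfl
    conv_lhs => rw [← ha']
    rw [← Set.image_comp, h, Set.image_id]

/-- For an adapted set `U` the stabilizer is `{g | Φ(g)(U) ∩ U ≠ ∅}`. -/
theorem mem_stab_iff {Φ : G →* (X ≃ₜ X)} {U : Set X} (hU : IsAdapted Φ U) (g : G) :
    g ∈ stab Φ U ↔ (Φ g '' U ∩ U).Nonempty := by
  constructor
  · intro h
    have h' : Φ g '' U = U := h
    rw [h', Set.inter_self]
    exact hU.1
  · exact hU.2.2 g

theorem apply_mem {Φ : G →* (X ≃ₜ X)} {U : Set X} {g : G} (hg : g ∈ stab Φ U) {x : X}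
    (hx : x ∈ U) : Φ g x ∈ U := by
  have h : Φ g '' U = U := hg
  rw [← h]
  exact Set.mem_image_of_mem _ hx

/-- The restricted action `Φ_U : G_U → Homeo(U)`, `Φ_U(g)(x) = Φ(g)(x)`. -/
def restrict (Φ : G →* (X ≃ₜ X)) (U : Set X) : stab Φ U →* (U ≃ₜ U) where
  toFun g :=
    { toFun := fun x => ⟨Φ g x, apply_mem g.2 x.2⟩
      invFun := fun x => ⟨Φ (g⁻¹ : stab Φ U) x, apply_mem (g⁻¹).2 x.2⟩
      left_inv := fun x => Subtype.ext <| by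
        show (Φ ((g : G)⁻¹) * Φ g) (x : X) = x
        rw [← map_mul, inv_mul_cancel, map_one]
        rfl
      right_inv := fun x => Subtype.ext <| by
        show (Φ g * Φ ((g : G)⁻¹)) (x : X) = x
        rw [← map_mul, mul_inv_cancel, map_one]
        rfl
      continuous_toFun :=
        ((Φ g).continuous.comp continuous_subtype_val).subtype_mk _
      continuous_invFun :=
        ((Φ (g⁻¹ : stab Φ U)).continuous.comp continuous_subtype_val).subtype_mk _ }
  map_one' := by
    ext x
    show Φ 1 (x : X) = x
    rw [map_one]
    rfl
  map_mul' a b := by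
    ext x
    show Φ ((a : G) * b) (x : X) = Φ a (Φ b x)
    rw [map_mul]
    rfl

/-- The restricted holonomy group: the image of `Φ_U : G_U → Homeo(U)`. -/
def holonomy (Φ : G →* (X ≃ₜ X)) (U : Set X) : Subgroup (U ≃ₜ U) :=
  (restrict Φ U).range

/-- The isomorphism `h_* : Homeo(X) → Homeo(Y)`, `φ ↦ h ∘ φ ∘ h⁻¹`, induced by a homeomorphism
`h : X → Y`. -/
def homeoConj (h : X ≃ₜ Y) : (X ≃ₜ X) ≃* (Y ≃ₜ Y) where
  toFun φ := (h.symm.trans φ).trans h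
  invFun ψ := (h.trans ψ).trans h.symm
  left_inv φ := by ext x; simp
  right_inv ψ := by ext x; simp
  map_mul' φ ψ := by
    ext y
    show h (φ (ψ (h.symm y))) = h (φ (h.symm (h (ψ (h.symm y)))))
    rw [h.symm_apply_apply]

/-- The topological full group `[[X, G, Φ]]`: all homeomorphisms of `X` which, on some clopen
neighbourhood of each point, agree with an element of the group. -/
def topologicalFullGroup (Φ : G →* (X ≃ₜ X)) : Subgroup (X ≃ₜ X) where
  carrier := {φ | ∀ x : X, ∃ U : Set X, IsClopen U ∧ x ∈ U ∧ ∃ g : G, Set.EqOn φ (Φ g) U}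
  one_mem' := by
    intro x
    refine ⟨Set.univ, isClopen_univ, Set.mem_univ x, 1, ?_⟩
    rw [map_one]
    exact fun _ _ => rfl
  mul_mem' := by
    intro φ ψ hφ hψ x
    obtain ⟨U, hU, hxU, g, hg⟩ := hψ x
    obtain ⟨V, hV, hxV, k, hk⟩ := hφ (ψ x)
    refine ⟨U ∩ ψ ⁻¹' V, hU.inter (hV.preimage ψ.continuous), ⟨hxU, hxV⟩, k * g, ?_⟩
    rintro y ⟨hyU, hyV⟩
    rw [map_mul]
    show φ (ψ y) = Φ k (Φ g y)
    rw [← hg hyU]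
    exact hk hyV
  inv_mem' := by
    intro φ hφ x
    obtain ⟨U, hU, hxU, g, hg⟩ := hφ (φ.symm x)
    refine ⟨φ.symm ⁻¹' U, hU.preimage φ.symm.continuous, hxU, g⁻¹, ?_⟩
    intro y hy
    have h : y = Φ g (φ.symm y) := by rw [← hg hy, φ.apply_symm_apply]
    rw [map_inv]
    show φ.symm y = (Φ g).symm y
    rw [Homeomorph.eq_symm_apply]
    exact h.symm

/-- The full groups of the two actions are virtually isomorphic: for some adapted clopen sets `U`
and `V`, the topological full groups `[[U, G_U, Φ_U]]` and `[[V, H_V, Ψ_V]]` of the restricted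
actions are isomorphic as abstract groups. -/
def VirtuallyIsomorphicFullGroups (Φ : G →* (X ≃ₜ X)) (Ψ : H →* (Y ≃ₜ Y)) : Prop :=
  ∃ (U : Set X) (V : Set Y), IsAdapted Φ U ∧ IsAdapted Ψ V ∧
    Nonempty (topologicalFullGroup (restrict Φ U) ≃* topologicalFullGroup (restrict Ψ V))

/-- Return equivalence: for some adapted clopen sets `U` and `V` there is a homeomorphism
`h : U → V` such that `h_*` restricts to an isomorphism of the restricted holonomy groups. -/
def ReturnEquivalent (Φ : G →* (X ≃ₜ X)) (Ψ : H →* (Y ≃ₜ Y)) : Prop :=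
  ∃ (U : Set X) (V : Set Y), IsAdapted Φ U ∧ IsAdapted Ψ V ∧
    ∃ h : U ≃ₜ V, (holonomy Φ U).map (homeoConj h).toMonoidHom = holonomy Ψ V

end Topological

section Metric

variable {G X : Type*} [Group G] [MetricSpace X]

/-- For every `ε > 0` there is `δ > 0` such that `d(x, y) < δ` implies `d(g x, g y) < ε` for all
`g` in the group. -/
def IsEquicontinuous (Φ : G →* (X ≃ₜ X)) : Prop :=
  UniformEquicontinuous fun (g : G) (x : X) => Φ g x

/-- Locally quasi-analytic: for some `ε > 0`, two group elements that agree on a non-empty open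
subset `V` of an open set `U` with diameter less than `ε` agree on `U`. -/
def IsLocallyQuasiAnalytic (Φ : G →* (X ≃ₜ X)) : Prop :=
  ∃ ε : ℝ, 0 < ε ∧ ∀ U : Set X, IsOpen U → U.Nonempty → Metric.diam U < ε →
    ∀ V : Set X, IsOpen V → V.Nonempty → V ⊆ U → ∀ g₁ g₂ : G,
      Set.EqOn (Φ g₁) (Φ g₂) V → Set.EqOn (Φ g₁) (Φ g₂) U

end Metric

end CantorAction

/-!
The proof has two independent halves.

*From the abstract group to the space.* On an adapted set `U`, the action of the stabilizer is
again minimal, so its full group contains, near every point, involutions that exchange two small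
disjoint clopen sets. For an involution `p` of such a group, the elements supported in the support
of `p` can be described in terms of the group multiplication alone
(`HasManyInvolutions.mem_supportedIn_iff`). An abstract isomorphism `q` of full groups therefore
preserves inclusions between supports of involutions. Local quasi-analyticity makes all supports
clopen (`isOpen_support_of_mem_topologicalFullGroup`), so the supports of involutions that contain
a point `x` form a neighbourhood basis of `x`, and the supports of their images under `q` shrink
to a single point `h x`. The map `h` is a homeomorphism and `q` is conjugation by `h`
(`HasManyInvolutions.exists_homeomorph`).

*From full groups to holonomy.* Now every element of either action is, through `h`, locally equal
to elements of the other. For the finitely many generators this holds on all balls of some radius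
by Lebesgue's number lemma, and by equicontinuity it then holds for all elements of the group on
all balls of some fixed, smaller radius (`IsEquicontinuous.exists_forall_ball`); the stabilizers
are finitely generated because they have finite index. Hence on an adapted set `A` that is small
enough, which exists by equicontinuity (`IsEquicontinuous.exists_isAdapted_subset`), the two
actions restrict to the same set of maps up to `h`. It follows that `h '' A` is adapted and that
`h` conjugates the holonomy groups (`returnEquivalent_of_forall_eqOn`).
-/

namespace CantorAction

/-! ### Supports of homeomorphisms -/

section Supports

variable {X : Type*} [TopologicalSpace X]

/-- The set of points moved by a homeomorphism. -/
def movedSet (φ : X ≃ₜ X) : Set X := {x | φ x ≠ x}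

/-- The support of a homeomorphism: the closure of the set of points it moves. -/
def support (φ : X ≃ₜ X) : Set X := closure (movedSet φ)

theorem movedSet_subset_support (φ : X ≃ₜ X) : movedSet φ ⊆ support φ := subset_closure

theorem isClosed_support (φ : X ≃ₜ X) : IsClosed (support φ) := isClosed_closure

theorem apply_eq_of_movedSet_subset {φ : X ≃ₜ X} {W : Set X} (h : movedSet φ ⊆ W) {x : X}
    (hx : x ∉ W) : φ x = x := by
  by_contra hne
  exact hx (h hne)

theorem apply_mem_of_movedSet_subset {φ : X ≃ₜ X} {W : Set X} (h : movedSet φ ⊆ W) {x : X}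
    (hx : x ∈ W) : φ x ∈ W := by
  by_contra hne
  rw [φ.injective (apply_eq_of_movedSet_subset h hne)] at hne
  exact hne hx

theorem movedSet_mul_subset {φ ψ : X ≃ₜ X} {W : Set X} (hφ : movedSet φ ⊆ W)
    (hψ : movedSet ψ ⊆ W) : movedSet (φ * ψ) ⊆ W := by
  intro x hx
  by_contra hxW
  apply hx
  rw [Homeomorph.mul_apply, apply_eq_of_movedSet_subset hψ hxW,
    apply_eq_of_movedSet_subset hφ hxW]

theorem support_conj (φ π : X ≃ₜ X) : support (φ * π * φ⁻¹) = φ '' support π := by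
  have h : movedSet (φ * π * φ⁻¹) = φ '' movedSet π := by
    ext x
    rw [Homeomorph.image_eq_preimage_symm]
    show φ (π (φ.symm x)) ≠ x ↔ π (φ.symm x) ≠ φ.symm x
    rw [Ne, Ne, Homeomorph.eq_symm_apply]
  rw [support, h, support, Homeomorph.image_closure]

theorem mul_apply_eq_of_forall {φ ψ : X ≃ₜ X} (h : ∀ x, φ x = x ∨ ψ x = x) (x : X) :
    φ (ψ x) = ψ (φ x) := by
  by_cases hψ : ψ x = x
  · rw [hψ]
    rcases h (φ x) with h' | h'
    · rw [φ.injective h', hψ]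
    · exact h'.symm
  · have h1 : φ x = x := (h x).resolve_right hψ
    rw [h1]
    exact (h (ψ x)).resolve_right fun h' => hψ (ψ.injective h')

theorem commute_of_forall {φ ψ : X ≃ₜ X} (h : ∀ x, φ x = x ∨ ψ x = x) : Commute φ ψ :=
  Homeomorph.ext (mul_apply_eq_of_forall h)

/-- Two homeomorphisms that each agree with `p` on a `p`-invariant set and are the identity off
that set commute. -/
theorem commute_of_piecewise {p σ σ' : X ≃ₜ X} {c c' : Set X}
    (hc : ∀ z, p z ∈ c ↔ z ∈ c) (hc' : ∀ z, p z ∈ c' ↔ z ∈ c')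
    (h1 : ∀ z ∈ c, σ z = p z) (h2 : ∀ z ∉ c, σ z = z)
    (h1' : ∀ z ∈ c', σ' z = p z) (h2' : ∀ z ∉ c', σ' z = z) : Commute σ σ' := by
  ext z
  show σ (σ' z) = σ' (σ z)
  by_cases hz : z ∈ c <;> by_cases hz' : z ∈ c'
  · rw [h1' z hz', h1 z hz, h1 _ ((hc z).2 hz), h1' _ ((hc' z).2 hz')]
  · rw [h2' z hz', h1 z hz, h2' _ (fun h => hz' ((hc' z).1 h))]
  · rw [h1' z hz', h2 z hz, h1' z hz', h2 _ (fun h => hz ((hc z).1 h))]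
  · rw [h2' z hz', h2 z hz, h2' z hz']

variable [T2Space X]

theorem exists_isClopen_image_disjoint [CompactSpace X] [TotallyDisconnectedSpace X] {φ : X ≃ₜ X}
    {x : X} (hx : φ x ≠ x) {W : Set X} (hW : IsOpen W) (hxW : x ∈ W) :
    ∃ b : Set X, IsClopen b ∧ x ∈ b ∧ b ⊆ W ∧ ∀ z ∈ b, φ z ∉ b := by
  obtain ⟨A, B, hA, hB, hxA, hxB, hAB⟩ := t2_separation hx
  obtain ⟨b, hb, hxb, hbs⟩ := compact_exists_isClopen_in_isOpen
    ((hW.inter hB).inter (hA.preimage φ.continuous)) ⟨⟨hxW, hxB⟩, hxA⟩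
  exact ⟨b, hb, hxb, fun z hz => (hbs hz).1.1, fun z hz hz' =>
    Set.disjoint_left.1 hAB (hbs hz).2 (hbs hz').1.2⟩

end Supports

/-! ### Supports of involutions in terms of the group structure -/

section Algebraic

variable {A B : Type*} [Group A] [Group B]

/-- The elements of the centralizer of `p` that commute with all their conjugates by elements
of the centralizer of `p`. -/
def commutingConjugates (p : A) : Set A :=
  {f | Commute f p ∧ ∀ k, Commute k p → Commute f (k * f * k⁻¹)}

/-- The centralizer of `commutingConjugates p`. -/
def almostFixing (p : A) : Set A := {f | ∀ u ∈ commutingConjugates p, Commute f u}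

/-- The elements that commute with all squares of elements of `almostFixing p`. For an involution
`p` in a group of homeomorphisms with many involutions these are the elements supported in the
support of `p`, see `mem_supportedIn_iff`. -/
def supportedIn (p : A) : Set A := {f | ∀ v ∈ almostFixing p, Commute f (v * v)}

theorem commute_map_iff (q : A ≃* B) {a b : A} : Commute (q a) (q b) ↔ Commute a b :=
  ⟨fun h => by simpa using h.map q.symm, fun h => h.map q⟩

theorem map_mem_commutingConjugates_iff (q : A ≃* B) {p f : A} :
    q f ∈ commutingConjugates (q p) ↔ f ∈ commutingConjugates p := by
  simp only [commutingConjugates, Set.mem_ofPred_eq, q.surjective.forall, commute_map_iff,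
    ← map_mul, ← map_inv]

theorem map_mem_almostFixing_iff (q : A ≃* B) {p f : A} :
    q f ∈ almostFixing (q p) ↔ f ∈ almostFixing p := by
  simp only [almostFixing, Set.mem_ofPred_eq, q.surjective.forall, commute_map_iff,
    map_mem_commutingConjugates_iff]

theorem map_mem_supportedIn_iff (q : A ≃* B) {p f : A} :
    q f ∈ supportedIn (q p) ↔ f ∈ supportedIn p := by
  simp only [supportedIn, Set.mem_ofPred_eq, q.surjective.forall, commute_map_iff,
    map_mem_almostFixing_iff, ← map_mul]

theorem map_involution (q : A ≃* B) {p : A} (hp : p * p = 1) : q p * q p = 1 := by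
  rw [← map_mul, hp, map_one]

end Algebraic

/-- A group of homeomorphisms has many involutions if involutions in it move any given point
inside any given neighbourhood of that point, if an involution in it may be cut off outside any
invariant clopen set, and if all supports are open (hence clopen). -/
structure HasManyInvolutions {X : Type*} [TopologicalSpace X] (F : Subgroup (X ≃ₜ X)) : Prop where
  exists_involution : ∀ (x : X) (W : Set X), IsOpen W → x ∈ W →
    ∃ π : F, π * π = 1 ∧ π.1 x ≠ x ∧ movedSet π.1 ⊆ W
  exists_cutoff : ∀ π : F, π * π = 1 → ∀ c : Set X, IsClopen c → (∀ z, π.1 z ∈ c ↔ z ∈ c) →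
    ∃ σ : F, (∀ z ∈ c, σ.1 z = π.1 z) ∧ ∀ z ∉ c, σ.1 z = z
  isOpen_support : ∀ φ : F, IsOpen (support φ.1)

namespace HasManyInvolutions

variable {X Y : Type*} [TopologicalSpace X] [TopologicalSpace Y] {F : Subgroup (X ≃ₜ X)}
  {F' : Subgroup (Y ≃ₜ Y)}

theorem exists_support_subset (hF : HasManyInvolutions F) {x : X} {W : Set X} (hW : IsClopen W)
    (hx : x ∈ W) : ∃ π : F, π * π = 1 ∧ x ∈ support π.1 ∧ support π.1 ⊆ W := by
  obtain ⟨π, h1, h2, h3⟩ := hF.exists_involution x W hW.isOpen hx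
  exact ⟨π, h1, subset_closure h2, closure_minimal h3 hW.isClosed⟩

theorem isClopen_support (hF : HasManyInvolutions F) (φ : F) : IsClopen (support φ.1) :=
  ⟨isClosed_support _, hF.isOpen_support φ⟩

theorem commute_of_forall {f g : F} (h : ∀ x, f.1 x = x ∨ g.1 x = x) : Commute f g :=
  Subtype.ext (CantorAction.commute_of_forall h)

theorem commute_apply {f g : F} (h : Commute f g) (x : X) : f.1 (g.1 x) = g.1 (f.1 x) :=
  congrArg (fun k : F => k.1 x) h.eq

theorem involution_apply {p : F} (hp : p * p = 1) (x : X) : p.1 (p.1 x) = x :=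
  congrArg (fun k : F => k.1 x) hp

theorem mem_commutingConjugates_of_cutoff {p σ : F} {c : Set X} (hc : ∀ z, p.1 z ∈ c ↔ z ∈ c)
    (h1 : ∀ z ∈ c, σ.1 z = p.1 z) (h2 : ∀ z ∉ c, σ.1 z = z) : σ ∈ commutingConjugates p := by
  refine ⟨Subtype.ext ?_, fun k hk => Subtype.ext ?_⟩
  · exact (commute_of_piecewise (p := p.1) (c' := Set.univ) hc (by simp) h1 h2 (by simp)
      (by simp)).eq
  · -- The conjugate of `σ` by `k` is `p` cut off outside `k c`.
    have hkp : ∀ z, k.1.symm (p.1 z) = p.1 (k.1.symm z) := by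
      intro z
      rw [Homeomorph.symm_apply_eq, commute_apply hk, Homeomorph.apply_symm_apply]
    refine (commute_of_piecewise (p := p.1) (σ' := (k * σ * k⁻¹).1) (c' := k.1.symm ⁻¹' c) hc ?_
      h1 h2 ?_ ?_).eq
    · intro z
      show k.1.symm (p.1 z) ∈ c ↔ k.1.symm z ∈ c
      rw [hkp, hc]
    · intro z hz
      show k.1 (σ.1 (k.1.symm z)) = p.1 z
      rw [h1 _ hz, ← hkp, Homeomorph.apply_symm_apply]
    · intro z hz
      show k.1 (σ.1 (k.1.symm z)) = z
      rw [h2 _ hz, Homeomorph.apply_symm_apply]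

variable [T2Space X] [CompactSpace X] [TotallyDisconnectedSpace X]

/-- Besides involutions, there are elements with small support whose square moves a given
point: the product of two non-commuting involutions, of order four. -/
theorem exists_mul_self_apply_ne (hF : HasManyInvolutions F) {x : X} {W : Set X} (hW : IsOpen W)
    (hx : x ∈ W) : ∃ ψ : F, ψ.1 (ψ.1 x) ≠ x ∧ movedSet ψ.1 ⊆ W := by
  obtain ⟨σ, hσ, hσx, hσW⟩ := hF.exists_involution x W hW hx
  obtain ⟨b, hb, hxb, hbW, hbσ⟩ := exists_isClopen_image_disjoint hσx hW hx
  obtain ⟨τ, hτ, hτx, hτb⟩ := hF.exists_involution x b hb.isOpen hxb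
  refine ⟨σ * τ, ?_, movedSet_mul_subset hσW (hτb.trans hbW)⟩
  show σ.1 (τ.1 (σ.1 (τ.1 x))) ≠ x
  have h1 : τ.1 x ∈ b := apply_mem_of_movedSet_subset hτb hxb
  rw [apply_eq_of_movedSet_subset hτb (hbσ _ h1), involution_apply hσ]
  exact hτx

/-- A point `x` moved by `f` outside the support of `p` would yield an element `ψ` of the
centralizer of `p`, supported near `x`, such that `f` does not commute with `ψ f ψ⁻¹`. -/
theorem movedSet_subset_of_mem_commutingConjugates (hF : HasManyInvolutions F) {p f : F}
    (hf : f ∈ commutingConjugates p) : movedSet f.1 ⊆ support p.1 := by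
  intro x hfx
  by_contra hx
  obtain ⟨b, hb, hxb, hbW, hbf⟩ :=
    exists_isClopen_image_disjoint hfx (isClosed_support p.1).isOpen_compl hx
  obtain ⟨ψ, hψx, hψb⟩ := hF.exists_mul_self_apply_ne hb.isOpen hxb
  have hψp : Commute ψ p := commute_of_forall fun z => by
    by_cases hz : z ∈ b
    · exact Or.inr (apply_eq_of_movedSet_subset (movedSet_subset_support _) (hbW hz))
    · exact Or.inl (apply_eq_of_movedSet_subset hψb hz)
  -- Evaluated at `f⁻¹ x`, the commutation of `f` and `ψ f ψ⁻¹` says `ψ x = ψ⁻¹ x`.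
  have hcomm := commute_apply (hf.2 ψ hψp) (f.1.symm x)
  obtain ⟨w, hw⟩ := ψ.1.surjective x
  have hwb : w ∈ b := by
    by_contra hwb
    have := apply_eq_of_movedSet_subset hψb hwb
    exact hwb (this ▸ hw ▸ hxb)
  have hz : f.1.symm x ∉ b := fun hz => hbf _ hz (by simpa using hxb)
  have hsz : ψ.1.symm (f.1.symm x) = f.1.symm x := by
    rw [Homeomorph.symm_apply_eq, apply_eq_of_movedSet_subset hψb hz]
  have hsx : ψ.1.symm x = w := by rw [Homeomorph.symm_apply_eq, hw]
  change f.1 (ψ.1 (f.1 (ψ.1.symm (f.1.symm x)))) = ψ.1 (f.1 (ψ.1.symm (f.1 (f.1.symm x)))) at hcomm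
  rw [hsz, Homeomorph.apply_symm_apply, hsx, apply_eq_of_movedSet_subset hψb (hbf w hwb)] at hcomm
  apply hψx
  rw [f.1.injective hcomm, hw]

/-- An element of `almostFixing p` preserves every `p`-invariant clopen subset of the support of
`p`, hence permutes each pair `{x, p x}`; so its square is trivial there. -/
theorem mul_self_apply_of_mem_almostFixing (hF : HasManyInvolutions F) {p v : F} (hp : p * p = 1)
    (hv : v ∈ almostFixing p) {x : X} (hx : x ∈ support p.1) : v.1 (v.1 x) = x := by
  have hp' := involution_apply hp
  have key : movedSet p.1 ⊆ {x | v.1 (v.1 x) = x} := by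
    intro x hpx
    have hor : v.1 x = x ∨ v.1 x = p.1 x := by
      by_contra! hne
      obtain ⟨n, hn, hxn, hns⟩ := compact_exists_isClopen_in_isOpen
        (U := {v.1 x}ᶜ ∩ {p.1 (v.1 x)}ᶜ) (isOpen_compl_singleton.inter isOpen_compl_singleton)
        (x := x) ⟨fun h => hne.1 h.symm, fun h => hne.2 (by
          rw [Set.mem_singleton_iff] at h
          rw [h, hp', ← h])⟩
      have hc : ∀ z, p.1 z ∈ n ∪ p.1 ⁻¹' n ↔ z ∈ n ∪ p.1 ⁻¹' n := by
        intro z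
        simp only [Set.mem_union, Set.mem_preimage, hp']
        exact or_comm
      obtain ⟨σ, h1, h2⟩ := hF.exists_cutoff p hp (n ∪ p.1 ⁻¹' n)
        (hn.union (hn.preimage p.1.continuous)) hc
      have hcomm := commute_apply (hv σ (mem_commutingConjugates_of_cutoff hc h1 h2)) x
      have hvx : v.1 x ∉ n ∪ p.1 ⁻¹' n := by
        rintro (h | h)
        · exact (hns h).1 rfl
        · exact (hns h).2 rfl
      rw [h2 _ hvx, h1 x (Or.inl hxn)] at hcomm
      exact hpx (v.1.injective hcomm)
    rcases hor with h | h
    · rw [Set.mem_ofPred_eq, h, h]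
    · have hpp : p ∈ commutingConjugates p :=
        mem_commutingConjugates_of_cutoff (c := Set.univ) (by simp) (by simp) (by simp)
      have := commute_apply (hv p hpp) x
      rw [Set.mem_ofPred_eq, h, this, h, hp']
  exact closure_minimal key
    (isClosed_eq (v.1.continuous.comp v.1.continuous) continuous_id) hx

theorem mem_supportedIn_iff (hF : HasManyInvolutions F) {p : F} (hp : p * p = 1) (f : F) :
    f ∈ supportedIn p ↔ movedSet f.1 ⊆ support p.1 := by
  constructor
  · intro hf x hfx
    by_contra hx
    obtain ⟨b, hb, hxb, hbW, hbf⟩ :=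
      exists_isClopen_image_disjoint hfx (isClosed_support p.1).isOpen_compl hx
    obtain ⟨ψ, hψx, hψb⟩ := hF.exists_mul_self_apply_ne hb.isOpen hxb
    have hψ : ψ ∈ almostFixing p := fun u hu => commute_of_forall fun z => by
      by_cases hz : z ∈ b
      · exact Or.inr (apply_eq_of_movedSet_subset
          (hF.movedSet_subset_of_mem_commutingConjugates hu) (hbW hz))
      · exact Or.inl (apply_eq_of_movedSet_subset hψb hz)
    have hcomm := commute_apply (hf ψ hψ) x
    change f.1 (ψ.1 (ψ.1 x)) = ψ.1 (ψ.1 (f.1 x)) at hcomm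
    have hfx' := apply_eq_of_movedSet_subset hψb (hbf x hxb)
    rw [hfx', hfx'] at hcomm
    exact hψx (f.1.injective hcomm)
  · intro hf v hv
    refine commute_of_forall fun x => ?_
    by_cases hx : x ∈ support p.1
    · exact Or.inr (hF.mul_self_apply_of_mem_almostFixing hp hv hx)
    · exact Or.inl (apply_eq_of_movedSet_subset hf hx)

theorem support_subset_iff (hF : HasManyInvolutions F) {p p' : F} (hp' : p' * p' = 1) :
    support p.1 ⊆ support p'.1 ↔ p ∈ supportedIn p' := by
  rw [hF.mem_supportedIn_iff hp']
  exact ⟨fun h => subset_closure.trans h, fun h => closure_minimal h (isClosed_support _)⟩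

/-! ### Reconstruction of the space from the group -/

variable [T2Space Y] [CompactSpace Y] [TotallyDisconnectedSpace Y]

theorem support_map_subset (hF : HasManyInvolutions F) (hF' : HasManyInvolutions F')
    (q : F ≃* F') {p p' : F} (hp' : p' * p' = 1) (h : support p.1 ⊆ support p'.1) :
    support (q p).1 ⊆ support (q p').1 := by
  rw [hF'.support_subset_iff (map_involution q hp'), map_mem_supportedIn_iff,
    ← hF.support_subset_iff hp']
  exact h

theorem support_map_inter_nonempty (hF : HasManyInvolutions F) (hF' : HasManyInvolutions F')
    (q : F ≃* F') {p p' : F} (hp : p * p = 1) (hp' : p' * p' = 1)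
    (h : (support p.1 ∩ support p'.1).Nonempty) :
    (support (q p).1 ∩ support (q p').1).Nonempty := by
  obtain ⟨x, hx⟩ := h
  obtain ⟨r, hr, hxr, hrs⟩ := hF.exists_support_subset
    ((hF.isClopen_support p).inter (hF.isClopen_support p')) hx
  have hne : (movedSet (q r).1).Nonempty := by
    by_contra hemp
    have h1 : q r = 1 := Subtype.ext <| Homeomorph.ext fun z => by
      by_contra hz
      exact hemp ⟨z, hz⟩
    have h2 : r = 1 := q.injective (h1.trans (map_one q).symm)
    rw [h2] at hxr
    have : movedSet (1 : F).1 = ∅ := by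
      ext z
      simp [movedSet]
    rw [support, this, closure_empty] at hxr
    exact hxr
  obtain ⟨y, hy⟩ := hne
  have hy' := subset_closure hy
  exact ⟨y, hF.support_map_subset hF' q hp (hrs.trans Set.inter_subset_left) hy',
    hF.support_map_subset hF' q hp' (hrs.trans Set.inter_subset_right) hy'⟩

/-- The point of `Y` that corresponds to `x`: it lies in the intersection of the supports of the
images of all involutions whose support contains `x`. -/
theorem exists_corresponding_point (hF : HasManyInvolutions F) (hF' : HasManyInvolutions F')
    (q : F ≃* F') (x : X) :
    ∃ y : Y, ∀ p : F, p * p = 1 → (y ∈ support (q p).1 ↔ x ∈ support p.1) := by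
  let I := {p : F // p * p = 1 ∧ x ∈ support p.1}
  obtain ⟨y, hy⟩ : (⋂ p : I, support (q p.1).1).Nonempty := by
    have : Nonempty I := by
      obtain ⟨p, hp, hxp, -⟩ := hF.exists_support_subset isClopen_univ (Set.mem_univ x)
      exact ⟨⟨p, hp, hxp⟩⟩
    refine IsCompact.nonempty_iInter_of_directed_nonempty_isCompact_isClosed _ ?_ ?_
      (fun p => (isClosed_support _).isCompact) (fun p => isClosed_support _)
    · rintro ⟨p, hp, hxp⟩ ⟨p', hp', hxp'⟩
      obtain ⟨r, hr, hxr, hrs⟩ := hF.exists_support_subset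
        ((hF.isClopen_support p).inter (hF.isClopen_support p')) ⟨hxp, hxp'⟩
      exact ⟨⟨r, hr, hxr⟩, hF.support_map_subset hF' q hp (hrs.trans Set.inter_subset_left),
        hF.support_map_subset hF' q hp' (hrs.trans Set.inter_subset_right)⟩
    · rintro ⟨p, hp, hxp⟩
      have := hF.support_map_inter_nonempty hF' q hp hp ⟨x, hxp, hxp⟩
      rwa [Set.inter_self] at this
  refine ⟨y, fun p hp => ⟨fun hyp => ?_, fun hxp => Set.mem_iInter.1 hy ⟨p, hp, hxp⟩⟩⟩
  by_contra hxp
  obtain ⟨r, hr, hxr, hrs⟩ := hF.exists_support_subset (hF.isClopen_support p).compl hxp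
  have hyr : y ∈ support (q r).1 := Set.mem_iInter.1 hy ⟨r, hr, hxr⟩
  have hne := hF'.support_map_inter_nonempty hF q.symm (map_involution q hr)
    (map_involution q hp) ⟨y, hyr, hyp⟩
  rw [q.symm_apply_apply, q.symm_apply_apply] at hne
  obtain ⟨z, hzr, hzp⟩ := hne
  exact hrs hzr hzp

theorem eq_of_forall_mem_support (hF : HasManyInvolutions F) {x x' : X}
    (h : ∀ p : F, p * p = 1 → x ∈ support p.1 → x' ∈ support p.1) : x = x' := by
  by_contra hne
  obtain ⟨W, hW, hxW, hWs⟩ := compact_exists_isClopen_in_isOpen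
    (isOpen_compl_singleton (x := x')) (x := x) hne
  obtain ⟨p, hp, hxp, hps⟩ := hF.exists_support_subset hW hxW
  exact hWs (hps (h p hp hxp)) rfl

/-- Every isomorphism between groups of homeomorphisms with many involutions is conjugation by a
homeomorphism of the underlying spaces. -/
theorem exists_homeomorph (hF : HasManyInvolutions F) (hF' : HasManyInvolutions F')
    (q : F ≃* F') : ∃ h : X ≃ₜ Y, ∀ (φ : F) (x : X), h (φ.1 x) = (q φ).1 (h x) := by
  choose h hh using hF.exists_corresponding_point hF' q
  choose k hk using hF'.exists_corresponding_point hF q.symm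
  have hh' : ∀ (x : X) (p : F'), p * p = 1 → (h x ∈ support p.1 ↔ x ∈ support (q.symm p).1) := by
    intro x p hp
    simpa using hh x (q.symm p) (map_involution q.symm hp)
  have hk' : ∀ (y : Y) (p : F), p * p = 1 → (k y ∈ support p.1 ↔ y ∈ support (q p).1) := by
    intro y p hp
    simpa using hk y (q p) (map_involution q hp)
  have hkh : ∀ x, k (h x) = x := fun x => Eq.symm <| hF.eq_of_forall_mem_support fun p hp hx =>
    (hk' _ p hp).2 ((hh x p hp).2 hx)
  have hhk : ∀ y, h (k y) = y := fun y => Eq.symm <| hF'.eq_of_forall_mem_support fun p hp hy =>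
    (hh' _ p hp).2 ((hk y p hp).2 hy)
  have hcont : Continuous h := by
    rw [continuous_iff_continuousAt]
    intro x
    rw [ContinuousAt, (isTopologicalBasis_isClopen.nhds_hasBasis).tendsto_right_iff]
    rintro W ⟨hW, hxW⟩
    obtain ⟨p, hp, hxp, hps⟩ := hF'.exists_support_subset hW hxW
    filter_upwards [(hF.isOpen_support (q.symm p)).mem_nhds ((hh' x p hp).1 hxp)] with z hz
    exact hps ((hh' z p hp).2 hz)
  let e : X ≃ₜ Y := hcont.homeoOfEquivCompactToT2 (f := ⟨h, k, hkh, hhk⟩)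
  refine ⟨e, fun φ x => ?_⟩
  show h (φ.1 x) = (q φ).1 (h x)
  refine hF'.eq_of_forall_mem_support fun p hp hx => ?_
  -- Transport the statement to `x` along conjugation by `φ`.
  have hp1 : (φ⁻¹ * q.symm p * φ) * (φ⁻¹ * q.symm p * φ) = 1 := by
    have := map_involution q.symm hp
    calc _ = φ⁻¹ * (q.symm p * q.symm p) * φ := by group
      _ = 1 := by rw [this]; group
  have e1 := (hh' _ p hp).1 hx
  have e2 : q.symm p = φ * (φ⁻¹ * q.symm p * φ) * φ⁻¹ := by group
  have e3 : (q.symm p).1 = φ.1 * (φ⁻¹ * q.symm p * φ).1 * (φ.1)⁻¹ := congrArg Subtype.val e2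
  rw [e3, support_conj, φ.1.injective.mem_set_image, ← hh x _ hp1] at e1
  have e4 : p = q φ * q (φ⁻¹ * q.symm p * φ) * (q φ)⁻¹ := by
    simp [mul_assoc]
  have e5 : p.1 = (q φ).1 * (q (φ⁻¹ * q.symm p * φ)).1 * ((q φ).1)⁻¹ := congrArg Subtype.val e4
  rw [e5, support_conj]
  exact Set.mem_image_of_mem _ e1

end HasManyInvolutions

/-! ### Topological full groups have many involutions -/

section FullGroup

variable {G X : Type*} [Group G] [TopologicalSpace X] {Φ : G →* (X ≃ₜ X)}

theorem inv_apply_apply (Φ : G →* (X ≃ₜ X)) (g : G) (x : X) : Φ g⁻¹ (Φ g x) = x := by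
  rw [map_inv]
  exact (Φ g).symm_apply_apply x

theorem apply_inv_apply (Φ : G →* (X ≃ₜ X)) (g : G) (x : X) : Φ g (Φ g⁻¹ x) = x := by
  rw [map_inv]
  exact (Φ g).apply_symm_apply x

theorem apply_mem_topologicalFullGroup (Φ : G →* (X ≃ₜ X)) (g : G) :
    Φ g ∈ topologicalFullGroup Φ :=
  fun x => ⟨Set.univ, isClopen_univ, Set.mem_univ x, g, fun _ _ => rfl⟩

/-- An involutive map that is locally given by the action belongs to the full group. -/
theorem exists_mem_topologicalFullGroup {f : X → X} (hf : Function.Involutive f)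
    (h : ∀ x, ∃ U : Set X, IsClopen U ∧ x ∈ U ∧ ∃ g : G, Set.EqOn f (Φ g) U) :
    ∃ φ : topologicalFullGroup Φ, ∀ x, φ.1 x = f x := by
  have hc : Continuous f := by
    rw [continuous_iff_continuousAt]
    intro x
    obtain ⟨U, hU, hxU, g, hg⟩ := h x
    exact (Φ g).continuous.continuousAt.congr
      (Filter.eventuallyEq_of_mem (hU.isOpen.mem_nhds hxU) hg).symm
  exact ⟨⟨⟨hf.toPerm f, hc, hc⟩, h⟩, fun x => rfl⟩

/-- If the translate of `A` by `g` is disjoint from `A`, the full group contains the involution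
that exchanges `A` with its translate. -/
theorem exists_swap {A : Set X} (hA : IsClopen A) {g : G} (hg : ∀ z ∈ A, Φ g z ∉ A) :
    ∃ π : topologicalFullGroup Φ, π * π = 1 ∧ (∀ z ∈ A, π.1 z = Φ g z) ∧
      movedSet π.1 ⊆ A ∪ Φ g⁻¹ ⁻¹' A := by
  classical
  set f : X → X := fun z => if z ∈ A then Φ g z else if Φ g⁻¹ z ∈ A then Φ g⁻¹ z else z
  have h1 : ∀ z ∈ A, f z = Φ g z := fun z hz => if_pos hz
  have hgA : ∀ z, Φ g⁻¹ z ∈ A → z ∉ A := fun z hz hzA => by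
    have := hg _ hz
    rw [apply_inv_apply] at this
    exact this hzA
  have h2 : ∀ z, Φ g⁻¹ z ∈ A → f z = Φ g⁻¹ z := fun z hz =>
    (if_neg (hgA z hz)).trans (if_pos hz)
  have h3 : ∀ z, z ∉ A → Φ g⁻¹ z ∉ A → f z = z := fun z hz hz' => (if_neg hz).trans (if_neg hz')
  have hinv : Function.Involutive f := by
    intro z
    by_cases hz : z ∈ A
    · rw [h1 z hz, h2 _ (by rwa [inv_apply_apply]), inv_apply_apply]
    by_cases hz' : Φ g⁻¹ z ∈ A
    · rw [h2 z hz', h1 _ hz', apply_inv_apply]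
    · rw [h3 z hz hz', h3 z hz hz']
  have hA' : IsClopen (Φ g⁻¹ ⁻¹' A) := hA.preimage (Φ g⁻¹).continuous
  obtain ⟨π, hπ⟩ := exists_mem_topologicalFullGroup (Φ := Φ) hinv fun x => by
    by_cases hz : x ∈ A
    · exact ⟨A, hA, hz, g, h1⟩
    by_cases hz' : Φ g⁻¹ x ∈ A
    · exact ⟨_, hA', hz', g⁻¹, h2⟩
    · refine ⟨_, hA.compl.inter hA'.compl, ⟨hz, hz'⟩, 1, fun y hy => ?_⟩
      rw [h3 y hy.1 hy.2, map_one, Homeomorph.one_apply]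
  refine ⟨π, Subtype.ext <| Homeomorph.ext fun z => ?_, fun z hz => (hπ z).trans (h1 z hz), ?_⟩
  · show π.1 (π.1 z) = z
    rw [hπ, hπ, hinv]
  · intro z hz
    by_contra hn
    rw [Set.mem_union, not_or] at hn
    exact hz ((hπ z).trans (h3 z hn.1 hn.2))

theorem exists_cutoff_topologicalFullGroup {π : topologicalFullGroup Φ} (hπ : π * π = 1)
    {c : Set X} (hc : IsClopen c) (hπc : ∀ z, π.1 z ∈ c ↔ z ∈ c) :
    ∃ σ : topologicalFullGroup Φ, (∀ z ∈ c, σ.1 z = π.1 z) ∧ ∀ z ∉ c, σ.1 z = z := by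
  classical
  have hππ := HasManyInvolutions.involution_apply hπ
  set f : X → X := fun z => if z ∈ c then π.1 z else z
  have h1 : ∀ z ∈ c, f z = π.1 z := fun z hz => if_pos hz
  have h2 : ∀ z ∉ c, f z = z := fun z hz => if_neg hz
  obtain ⟨σ, hσ⟩ := exists_mem_topologicalFullGroup (Φ := Φ) (f := f) (fun z => by
      by_cases hz : z ∈ c
      · rw [h1 z hz, h1 _ ((hπc z).2 hz), hππ]
      · rw [h2 z hz, h2 z hz]) fun x => by
    by_cases hx : x ∈ c
    · obtain ⟨U, hU, hxU, g, hg⟩ := π.2 x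
      exact ⟨U ∩ c, hU.inter hc, ⟨hxU, hx⟩, g, fun z hz => (h1 z hz.2).trans (hg hz.1)⟩
    · refine ⟨cᶜ, hc.compl, hx, 1, fun z hz => ?_⟩
      rw [h2 z hz, map_one, Homeomorph.one_apply]
  exact ⟨σ, fun z hz => (hσ z).trans (h1 z hz), fun z hz => (hσ z).trans (h2 z hz)⟩

/-- If every point has a neighbourhood on which the action is quasi-analytic, the supports of the
elements of the full group are open. -/
theorem isOpen_support_of_mem_topologicalFullGroup
    (h : ∀ x : X, ∃ W : Set X, IsOpen W ∧ x ∈ W ∧ ∀ U ⊆ W, IsOpen U → ∀ V ⊆ U, IsOpen V →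
      V.Nonempty → ∀ g : G, (∀ z ∈ V, Φ g z = z) → ∀ z ∈ U, Φ g z = z)
    {φ : X ≃ₜ X} (hφ : φ ∈ topologicalFullGroup Φ) : IsOpen (support φ) := by
  rw [isOpen_iff_mem_nhds]
  intro x hx
  obtain ⟨U, hU, hxU, g, hg⟩ := hφ x
  obtain ⟨W, hW, hxW, hqa⟩ := h x
  -- A neighbourhood of `x` that misses part of the support would be fixed pointwise.
  filter_upwards [(hU.isOpen.inter hW).mem_nhds ⟨hxU, hxW⟩] with y hy
  by_contra hys
  have hfix := hqa (U ∩ W) Set.inter_subset_right (hU.isOpen.inter hW)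
    (U ∩ W ∩ (support φ)ᶜ) Set.inter_subset_left
    ((hU.isOpen.inter hW).inter (isClosed_support φ).isOpen_compl) ⟨y, hy, hys⟩ g
    (fun z hz => (hg hz.1.1).symm.trans (apply_eq_of_movedSet_subset subset_closure hz.2))
  obtain ⟨z, hz, hzm⟩ := mem_closure_iff.1 hx _ (hU.isOpen.inter hW) ⟨hxU, hxW⟩
  exact hzm ((hg hz.1).trans (hfix z hz))

variable [T2Space X] [CompactSpace X] [TotallyDisconnectedSpace X]

theorem IsMinimal.hasManyInvolutions [PerfectSpace X] (hmin : IsMinimal Φ)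
    (h : ∀ x : X, ∃ W : Set X, IsOpen W ∧ x ∈ W ∧ ∀ U ⊆ W, IsOpen U → ∀ V ⊆ U, IsOpen V →
      V.Nonempty → ∀ g : G, (∀ z ∈ V, Φ g z = z) → ∀ z ∈ U, Φ g z = z) :
    HasManyInvolutions (topologicalFullGroup Φ) where
  exists_involution := by
    intro x W hW hx
    have hne : (W ∩ {x}ᶜ).Nonempty :=
      (Filter.nonempty_of_mem (inter_mem_nhdsWithin {x}ᶜ (hW.mem_nhds hx))).mono
        fun z hz => ⟨hz.2, hz.1⟩
    obtain ⟨_, ⟨hgW, hgx⟩, g, rfl⟩ :=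
      (hmin x).inter_open_nonempty _ (hW.inter isOpen_compl_singleton) hne
    obtain ⟨A, hA, hxA, hAW, hAg⟩ := exists_isClopen_image_disjoint (φ := Φ g) hgx
      (hW.inter (hW.preimage (Φ g).continuous)) ⟨hx, hgW⟩
    obtain ⟨π, hπ, hπA, hπs⟩ := exists_swap hA hAg
    refine ⟨π, hπ, by rw [hπA x hxA]; exact hgx, hπs.trans ?_⟩
    rintro z (hz | hz)
    · exact (hAW hz).1
    · have := (hAW hz).2
      rwa [Set.mem_preimage, apply_inv_apply] at this
  exists_cutoff π hπ c hc hπc := exists_cutoff_topologicalFullGroup hπ hc hπc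
  isOpen_support φ := isOpen_support_of_mem_topologicalFullGroup h φ.2

end FullGroup

/-! ### Orbit equivalences of equicontinuous actions -/

section Local

variable {G H X Y : Type*} [Group G] [Group H] [MetricSpace X] [TopologicalSpace Y]

/-- Let `h` conjugate an equicontinuous action `Φ` of a finitely generated group into the full
group of `Ψ`. Then on all balls of some fixed radius, every `Φ g` corresponds to a single
`Ψ k`. For generators this is Lebesgue's number lemma; equicontinuity keeps all translates of a
small ball below the Lebesgue number, so that words can be treated letter by letter. -/
theorem IsEquicontinuous.exists_forall_ball [CompactSpace X] [Group.FG G]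
    {Φ : G →* (X ≃ₜ X)} {Ψ : H →* (Y ≃ₜ Y)} (heq : IsEquicontinuous Φ) (h : X ≃ₜ Y)
    (hfull : ∀ g, homeoConj h (Φ g) ∈ topologicalFullGroup Ψ) :
    ∃ δ > 0, ∀ (g : G) (x : X), ∃ k : H, ∀ z ∈ Metric.ball x δ, h (Φ g z) = Ψ k (h z) := by
  have hone : ∀ g : G, ∃ η > 0, ∀ x : X, ∃ k : H,
      ∀ z ∈ Metric.ball x η, h (Φ g z) = Ψ k (h z) := by
    intro g
    choose U hU hxU k hk using hfull g
    obtain ⟨η, hη, hball⟩ := lebesgue_number_lemma_of_metric (isCompact_univ (X := X))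
      (c := fun x => h ⁻¹' U (h x)) (fun x => (hU _).isOpen.preimage h.continuous)
      (fun x _ => Set.mem_iUnion.2 ⟨x, hxU (h x)⟩)
    refine ⟨η, hη, fun x => ?_⟩
    obtain ⟨i, hi⟩ := hball x (Set.mem_univ x)
    refine ⟨k (h i), fun z hz => ?_⟩
    have := hk (h i) (hi hz)
    change h (Φ g (h.symm (h z))) = _ at this
    rwa [h.symm_apply_apply] at this
  obtain ⟨S, hS⟩ := Group.fg_def.1 (inferInstance : Group.FG G)
  choose η hη hηk using hone
  obtain ⟨η₀, hη₀, hle⟩ : ∃ η₀ > 0, ∀ s ∈ S, η₀ < η s ∧ η₀ < η s⁻¹ := by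
    have : ∀ᶠ r in nhdsWithin (0 : ℝ) (Set.Ioi 0), ∀ s ∈ S, r < η s ∧ r < η s⁻¹ := by
      rw [Filter.eventually_all_finset]
      intro s _
      exact ((eventually_lt_nhds (hη s)).and (eventually_lt_nhds (hη s⁻¹))).filter_mono
        nhdsWithin_le_nhds
    obtain ⟨r, hr, hr0⟩ := (this.and self_mem_nhdsWithin).exists
    exact ⟨r, hr0, hr⟩
  obtain ⟨δ, hδ, hδη⟩ := Metric.uniformEquicontinuous_iff.1 heq η₀ hη₀
  refine ⟨δ, hδ, fun g x => ?_⟩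
  have step : ∀ s g : G, η₀ < η s →
      (∃ k : H, ∀ z ∈ Metric.ball x δ, h (Φ g z) = Ψ k (h z)) →
      ∃ k : H, ∀ z ∈ Metric.ball x δ, h (Φ (s * g) z) = Ψ k (h z) := by
    rintro s g hs ⟨k, hk⟩
    obtain ⟨l, hl⟩ := hηk s (Φ g x)
    refine ⟨l * k, fun z hz => ?_⟩
    rw [map_mul, map_mul, Homeomorph.mul_apply, Homeomorph.mul_apply, ← hk z hz]
    exact hl _ ((hδη z x hz g).trans hs)
  have hg : g ∈ Subgroup.closure (S : Set G) := hS ▸ Subgroup.mem_top g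
  induction hg using Subgroup.closure_induction_left with
  | one => exact ⟨1, fun z _ => by simp⟩
  | mul_left s hs g _ ih => exact step s g (hle s hs).1 ih
  | inv_mul_cancel s hs g _ ih => exact step s⁻¹ g (hle s hs).2 ih

end Local

/-! ### Adapted sets -/

section Adapted

/-- An equicontinuous action on a compact totally disconnected space has arbitrarily small adapted
sets around every point `x`: for a clopen set `P`, the points `y` with `g y ∈ P ↔ g x ∈ P` for
all `g` form such a set. -/
theorem IsEquicontinuous.exists_isAdapted_subset {G X : Type*} [Group G] [MetricSpace X]
    [CompactSpace X] [TotallyDisconnectedSpace X] {Φ : G →* (X ≃ₜ X)} (heq : IsEquicontinuous Φ)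
    {x : X} {W : Set X} (hW : IsOpen W) (hx : x ∈ W) :
    ∃ A : Set X, IsAdapted Φ A ∧ x ∈ A ∧ A ⊆ W := by
  obtain ⟨P, hP, hxP, hPW⟩ := compact_exists_isClopen_in_isOpen hW hx
  obtain ⟨ε, hε, hball⟩ : ∃ ε > 0, ∀ y z : X, dist y z < ε → (y ∈ P ↔ z ∈ P) := by
    obtain ⟨ε, hε, hball⟩ := lebesgue_number_lemma_of_metric (isCompact_univ (X := X))
      (c := fun b : Bool => if b then P else Pᶜ)
      (fun b => by cases b <;> simp [hP.isOpen, hP.isClosed])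
      (fun y _ => Set.mem_iUnion.2 <| by
        by_cases hy : y ∈ P
        · exact ⟨true, by simpa using hy⟩
        · exact ⟨false, by simpa using hy⟩)
    refine ⟨ε, hε, fun y z hyz => ?_⟩
    obtain ⟨b, hb⟩ := hball z (Set.mem_univ z)
    have hy := hb (Metric.mem_ball.2 hyz)
    have hz := hb (Metric.mem_ball_self hε)
    cases b
    · simp only [Bool.false_eq_true, if_false] at hy hz
      exact iff_of_false hy hz
    · simp only [if_true] at hy hz
      exact iff_of_true hy hz
  obtain ⟨δ, hδ, hδε⟩ := Metric.uniformEquicontinuous_iff.1 heq ε hε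
  let A : X → Set X := fun y => {z | ∀ g, Φ g z ∈ P ↔ Φ g y ∈ P}
  have hopen : ∀ T : Set X, (∀ y z, (∀ g, Φ g z ∈ P ↔ Φ g y ∈ P) → y ∈ T → z ∈ T) → IsOpen T := by
    intro T hT
    rw [Metric.isOpen_iff]
    exact fun y hy => ⟨δ, hδ, fun z hz => hT y z (fun g => hball _ _ (hδε z y hz g)) hy⟩
  have hAo : IsOpen (A x) := hopen _ fun y z hyz hy g => (hyz g).trans (hy g)
  have hAc : IsClosed (A x) := ⟨hopen _ fun y z hyz hy hz => hy fun g => (hyz g).symm.trans (hz g)⟩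
  have hAW : A x ⊆ W := by
    intro z hz
    have := (hz 1).2
    simp only [map_one, Homeomorph.one_apply] at this
    exact hPW (this hxP)
  refine ⟨A x, ⟨⟨x, fun g => Iff.rfl⟩, ⟨hAc, hAo⟩, ?_⟩, fun g => Iff.rfl, hAW⟩
  rintro g ⟨_, ⟨y, hy, rfl⟩, hgy⟩
  -- `A x` is the class of `x` under an invariant equivalence relation.
  have hmove : ∀ k y z, (∀ g, Φ g z ∈ P ↔ Φ g y ∈ P) → ∀ g, Φ g (Φ k z) ∈ P ↔ Φ g (Φ k y) ∈ P := by
    intro k y z h g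
    have := h (g * k)
    rwa [map_mul] at this
  apply Set.Subset.antisymm
  · rintro _ ⟨z, hz, rfl⟩ l
    exact (hmove g y z (fun m => (hz m).trans (hy m).symm) l).trans (hgy l)
  · intro z hz
    refine ⟨Φ g⁻¹ z, fun l => ?_, apply_inv_apply Φ g z⟩
    have := hmove g⁻¹ (Φ g y) z (fun m => (hz m).trans (hgy m).symm) l
    rw [inv_apply_apply] at this
    exact this.trans (hy l)

variable {G X : Type*} [Group G] [TopologicalSpace X] {Φ : G →* (X ≃ₜ X)} {U : Set X}

theorem IsAdapted.mem_stab (hU : IsAdapted Φ U) {g : G} {x : X} (hx : x ∈ U) (hgx : Φ g x ∈ U) :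
    g ∈ stab Φ U :=
  (mem_stab_iff hU g).2 ⟨_, Set.mem_image_of_mem _ hx, hgx⟩

/-- By minimality and compactness, finitely many translates of an adapted set cover the space. -/
theorem IsAdapted.finiteIndex_stab [CompactSpace X] (hmin : IsMinimal Φ) (hU : IsAdapted Φ U) :
    (stab Φ U).FiniteIndex := by
  obtain ⟨t, ht⟩ := isCompact_univ.elim_finite_subcover (fun g : G => Φ g⁻¹ ⁻¹' U)
    (fun g => hU.2.1.isOpen.preimage (Φ g⁻¹).continuous) (fun x _ => by
      obtain ⟨_, hgx, g, rfl⟩ := (hmin x).inter_open_nonempty _ hU.2.1.isOpen hU.1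
      exact Set.mem_iUnion.2 ⟨g⁻¹, by rwa [Set.mem_preimage, inv_inv]⟩)
  have hsurj : Function.Surjective (fun g : t => (g.1 : G ⧸ stab Φ U)) := by
    intro k
    induction k using QuotientGroup.induction_on with
    | H k =>
      obtain ⟨x, hx⟩ := hU.1
      obtain ⟨g, hg, hgk⟩ := Set.mem_iUnion₂.1 (ht (Set.mem_univ (Φ k x)))
      refine ⟨⟨g, hg⟩, QuotientGroup.eq.2 (hU.mem_stab hx ?_)⟩
      rw [map_mul]
      exact hgk
  have : Finite (G ⧸ stab Φ U) := Finite.of_surjective _ hsurj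
  exact Subgroup.finiteIndex_of_finite_quotient

theorem IsMinimal.restrict (hmin : IsMinimal Φ) (hU : IsAdapted Φ U) :
    IsMinimal (restrict Φ U) := by
  intro x
  rw [dense_iff_inter_open]
  rintro W hW ⟨w, hw⟩
  obtain ⟨_, ⟨y, hy, hyx⟩, g, rfl⟩ := (hmin x).inter_open_nonempty (Subtype.val '' W)
    (hU.2.1.isOpen.isOpenEmbedding_subtypeVal.isOpenMap W hW) ⟨w, w, hw, rfl⟩
  have hg : g ∈ stab Φ U := hU.mem_stab x.2 (Set.mem_of_eq_of_mem hyx.symm y.2)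
  refine ⟨_, ?_, ⟨g, hg⟩, rfl⟩
  convert hy
  exact Subtype.ext hyx.symm

/-- Sets adapted to the restricted action on an adapted set are adapted. -/
theorem IsAdapted.image_val (hU : IsAdapted Φ U) {A : Set U} (hA : IsAdapted (restrict Φ U) A) :
    IsAdapted Φ (Subtype.val '' A) := by
  refine ⟨hA.1.image _, ⟨hU.2.1.isClosed.isClosedEmbedding_subtypeVal.isClosedMap _
    hA.2.1.isClosed, hU.2.1.isOpen.isOpenEmbedding_subtypeVal.isOpenMap _ hA.2.1.isOpen⟩, ?_⟩
  rintro g ⟨_, ⟨_, ⟨a, ha, rfl⟩, rfl⟩, b, hb, hab⟩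
  have hg : g ∈ stab Φ U := hU.mem_stab a.2 (by rw [← hab]; exact b.2)
  have h := hA.2.2 ⟨g, hg⟩ ⟨b, ⟨a, ha, Subtype.ext hab.symm⟩, hb⟩
  calc Φ g '' (Subtype.val '' A) = Subtype.val '' (CantorAction.restrict Φ U ⟨g, hg⟩ '' A) := by
        rw [Set.image_image, Set.image_image]
        rfl
    _ = Subtype.val '' A := by rw [h]

end Adapted

section RestrictMetric

variable {G X : Type*} [Group G] [MetricSpace X] {Φ : G →* (X ≃ₜ X)} {U : Set X}

theorem IsEquicontinuous.restrict (heq : IsEquicontinuous Φ) (U : Set X) :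
    IsEquicontinuous (restrict Φ U) := by
  refine Metric.uniformEquicontinuous_iff.2 fun ε hε => ?_
  obtain ⟨δ, hδ, h⟩ := Metric.uniformEquicontinuous_iff.1 heq ε hε
  exact ⟨δ, hδ, fun x y hxy g => h x y hxy g⟩

theorem IsLocallyQuasiAnalytic.restrict (hqa : IsLocallyQuasiAnalytic Φ) (hU : IsOpen U) (x : U) :
    ∃ W : Set U, IsOpen W ∧ x ∈ W ∧ ∀ T ⊆ W, IsOpen T → ∀ V ⊆ T, IsOpen V → V.Nonempty →
      ∀ g : stab Φ U, (∀ z ∈ V, restrict Φ U g z = z) → ∀ z ∈ T, restrict Φ U g z = z := by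
  obtain ⟨ε, hε, h⟩ := hqa
  refine ⟨Metric.ball x (ε / 3), Metric.isOpen_ball, Metric.mem_ball_self (by positivity), ?_⟩
  intro T hTW hT V hVT hV hVne g hg z hz
  have hval := hU.isOpenEmbedding_subtypeVal.isOpenMap
  have hdiam : Metric.diam (Subtype.val '' T : Set X) < ε := by
    calc Metric.diam (Subtype.val '' T : Set X) ≤ 2 * (ε / 3) := by
          refine Metric.diam_le_of_forall_dist_le (by positivity) ?_
          rintro _ ⟨a, ha, rfl⟩ _ ⟨b, hb, rfl⟩
          have h1 := Metric.mem_ball.1 (hTW ha)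
          have h2 := Metric.mem_ball'.1 (hTW hb)
          have h3 : dist a b ≤ 2 * (ε / 3) := by linarith [dist_triangle a x b]
          exact h3
      _ < ε := by linarith
  have := h (Subtype.val '' T) (hval T hT) ((hVne.mono hVT).image _) hdiam (Subtype.val '' V)
    (hval V hV) (hVne.image _) (Set.image_mono hVT) g 1 (by
      rintro _ ⟨a, ha, rfl⟩
      rw [map_one, Homeomorph.one_apply]
      exact congrArg Subtype.val (hg a ha)) ⟨z, hz, rfl⟩
  rw [map_one, Homeomorph.one_apply] at this
  exact Subtype.ext this

theorem hasManyInvolutions_restrict (hX : IsCantorSpace X) (hmin : IsMinimal Φ)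
    (hqa : IsLocallyQuasiAnalytic Φ) (hU : IsAdapted Φ U) :
    HasManyInvolutions (topologicalFullGroup (restrict Φ U)) := by
  have := hX.compact
  have := hX.totallyDisconnected
  have := hX.perfect
  have : CompactSpace U := isCompact_iff_compactSpace.1 hU.2.1.isClosed.isCompact
  have : PerfectSpace U := by
    rw [perfectSpace_iff_forall_not_isolated]
    intro x
    rw [Filter.neBot_iff, Ne, ← isOpen_singleton_iff_punctured_nhds]
    intro hx
    have hx' := hU.2.1.isOpen.isOpenEmbedding_subtypeVal.isOpenMap _ hx
    rw [Set.image_singleton, isOpen_singleton_iff_punctured_nhds] at hx'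
    exact (PerfectSpace.not_isolated (x : X)).ne hx'
  exact (hmin.restrict hU).hasManyInvolutions (hqa.restrict hU.2.1.isOpen)

end RestrictMetric

/-! ### Return equivalence -/

section Return

variable {G H X Y : Type*} [Group G] [Group H] [TopologicalSpace X] [TopologicalSpace Y]
  {Φ : G →* (X ≃ₜ X)} {Ψ : H →* (Y ≃ₜ Y)}

/-- A homeomorphism `e : A ≃ₜ B` identifies the holonomy groups as soon as each element of one
stabilizer corresponds under `e` to some element of the other. -/
theorem map_holonomy_eq {A : Set X} {B : Set Y} (e : A ≃ₜ B)
    (h1 : ∀ g : stab Φ A, ∃ k : stab Ψ B, ∀ a, e (restrict Φ A g a) = restrict Ψ B k (e a))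
    (h2 : ∀ k : stab Ψ B, ∃ g : stab Φ A, ∀ a, e (restrict Φ A g a) = restrict Ψ B k (e a)) :
    (holonomy Φ A).map (homeoConj e).toMonoidHom = holonomy Ψ B := by
  have key : ∀ (g : stab Φ A) (k : stab Ψ B),
      (∀ a, e (restrict Φ A g a) = restrict Ψ B k (e a)) →
      homeoConj e (restrict Φ A g) = restrict Ψ B k := by
    intro g k h
    ext1 b
    show e (restrict Φ A g (e.symm b)) = _
    rw [h, e.apply_symm_apply]
  apply le_antisymm
  · rintro _ ⟨_, ⟨g, rfl⟩, rfl⟩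
    obtain ⟨k, hk⟩ := h1 g
    exact ⟨k, (key g k hk).symm⟩
  · rintro _ ⟨k, rfl⟩
    obtain ⟨g, hg⟩ := h2 k
    exact ⟨_, ⟨g, rfl⟩, key g k hg⟩

/-- If the elements of `Φ` and `Ψ` have the same restrictions to an adapted set `A`, up to a
homeomorphism `h`, then `h '' A` is adapted and `h` identifies the holonomy groups. -/
theorem returnEquivalent_of_forall_eqOn (h : X ≃ₜ Y) {A : Set X} (hA : IsAdapted Φ A)
    (h1 : ∀ g : G, ∃ k : H, ∀ a ∈ A, h (Φ g a) = Ψ k (h a))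
    (h2 : ∀ k : H, ∃ g : G, ∀ a ∈ A, h (Φ g a) = Ψ k (h a)) :
    ReturnEquivalent Φ Ψ := by
  have himage : ∀ (g : G) (k : H), (∀ a ∈ A, h (Φ g a) = Ψ k (h a)) →
      Ψ k '' (h '' A) = h '' (Φ g '' A) := by
    intro g k hgk
    rw [Set.image_image, Set.image_image]
    exact Set.image_congr fun a ha => (hgk a ha).symm
  have hB : IsAdapted Ψ (h '' A) := by
    refine ⟨hA.1.image _, ⟨h.isClosedMap _ hA.2.1.isClosed, h.isOpenMap _ hA.2.1.isOpen⟩, ?_⟩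
    intro k hk
    obtain ⟨g, hg⟩ := h2 k
    rw [himage g k hg, ← Set.image_inter h.injective, Set.image_nonempty] at hk
    rw [himage g k hg, hA.2.2 g hk]
  refine ⟨A, h '' A, hA, hB, h.image A, map_holonomy_eq _ ?_ ?_⟩
  · rintro ⟨g, hg⟩
    obtain ⟨k, hk⟩ := h1 g
    have hkB : k ∈ stab Ψ (h '' A) := (himage g k hk).trans (congrArg _ hg)
    exact ⟨⟨k, hkB⟩, fun a => Subtype.ext (hk a a.2)⟩
  · rintro ⟨k, hkB⟩
    obtain ⟨g, hg⟩ := h2 k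
    have hgA : g ∈ stab Φ A := h.injective.image_injective ((himage g k hg).symm.trans hkB)
    exact ⟨⟨g, hgA⟩, fun a => Subtype.ext (hg a a.2)⟩

/-- The restricted actions on an adapted set `U` and on a smaller adapted set have the same
holonomy on the smaller set. -/
theorem map_holonomy_image_val {U : Set X} (hU : IsAdapted Φ U) {A : Set U} (hA : A.Nonempty) :
    (holonomy (restrict Φ U) A).map
      (homeoConj (Topology.IsEmbedding.subtypeVal.homeomorphImage A)).toMonoidHom =
      holonomy Φ (Subtype.val '' A) := by
  have himage : ∀ g : stab Φ U,
      Φ g '' (Subtype.val '' A) = Subtype.val '' (restrict Φ U g '' A) := by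
    intro g
    rw [Set.image_image, Set.image_image]
    rfl
  refine map_holonomy_eq _ ?_ ?_
  · rintro ⟨g, hg⟩
    exact ⟨⟨g, (himage g).trans (congrArg _ hg)⟩, fun a => rfl⟩
  · rintro ⟨k, hk⟩
    obtain ⟨a, ha⟩ := hA
    obtain ⟨b, -, hb⟩ := apply_mem hk (Set.mem_image_of_mem _ ha)
    have hkU : k ∈ stab Φ U := hU.mem_stab a.2 (Set.mem_of_eq_of_mem hb.symm b.2)
    exact ⟨⟨⟨k, hkU⟩, Subtype.val_injective.image_injective ((himage ⟨k, hkU⟩).symm.trans hk)⟩,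
      fun a => rfl⟩

theorem map_homeoConj_trans {Z : Type*} [TopologicalSpace Z] (e : X ≃ₜ Y) (f : Y ≃ₜ Z)
    (K : Subgroup (X ≃ₜ X)) :
    K.map (homeoConj (e.trans f)).toMonoidHom =
      (K.map (homeoConj e).toMonoidHom).map (homeoConj f).toMonoidHom := by
  rw [Subgroup.map_map]
  rfl

theorem ReturnEquivalent.of_restrict {U : Set X} {V : Set Y} (hU : IsAdapted Φ U)
    (hV : IsAdapted Ψ V) (h : ReturnEquivalent (restrict Φ U) (restrict Ψ V)) :
    ReturnEquivalent Φ Ψ := by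
  obtain ⟨A, B, hA, hB, e, he⟩ := h
  let i := Topology.IsEmbedding.subtypeVal.homeomorphImage A
  let j := Topology.IsEmbedding.subtypeVal.homeomorphImage B
  refine ⟨_, _, hU.image_val hA, hV.image_val hB, i.symm.trans (e.trans j), ?_⟩
  have hij : i.trans (i.symm.trans (e.trans j)) = e.trans j := by
    ext1 x
    simp
  rw [← map_holonomy_image_val hU hA.1, ← map_holonomy_image_val hV hB.1, ← he,
    ← map_homeoConj_trans, ← map_homeoConj_trans, hij]

end Return

end CantorAction

theorem mainTheorem5 {X Y G H : Type*} [MetricSpace X] [MetricSpace Y] [Group G] [Group H]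
    (hX : IsCantorSpace X) (hY : IsCantorSpace Y) [Group.FG G] [Group.FG H]
    (Φ : G →* (X ≃ₜ X)) (Ψ : H →* (Y ≃ₜ Y))
    (hΦmin : CantorAction.IsMinimal Φ) (hΨmin : CantorAction.IsMinimal Ψ)
    (hΦeq : CantorAction.IsEquicontinuous Φ) (hΨeq : CantorAction.IsEquicontinuous Ψ)
    (hΦlqa : CantorAction.IsLocallyQuasiAnalytic Φ)
    (hΨlqa : CantorAction.IsLocallyQuasiAnalytic Ψ)
    (hvirt : CantorAction.VirtuallyIsomorphicFullGroups Φ Ψ) :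
    CantorAction.ReturnEquivalent Φ Ψ := by
  open CantorAction in
  obtain ⟨U, V, hU, hV, ⟨q⟩⟩ := hvirt
  have := hX.compact
  have := hY.compact
  have := hX.totallyDisconnected
  have := hY.totallyDisconnected
  have : CompactSpace U := isCompact_iff_compactSpace.1 hU.2.1.isClosed.isCompact
  have : CompactSpace V := isCompact_iff_compactSpace.1 hV.2.1.isClosed.isCompact
  have := hU.finiteIndex_stab hΦmin
  have := hV.finiteIndex_stab hΨmin
  obtain ⟨h, hh⟩ := (hasManyInvolutions_restrict hX hΦmin hΦlqa hU).exists_homeomorph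
    (hasManyInvolutions_restrict hY hΨmin hΨlqa hV) q
  have h1 : ∀ g, homeoConj h (restrict Φ U g) ∈ topologicalFullGroup (restrict Ψ V) := by
    intro g
    have : homeoConj h (restrict Φ U g) = (q ⟨_, apply_mem_topologicalFullGroup _ g⟩).1 := by
      ext1 y
      refine (hh ⟨_, apply_mem_topologicalFullGroup _ g⟩ (h.symm y)).trans ?_
      rw [h.apply_symm_apply]
    rw [this]
    exact Subtype.property _
  have h2 : ∀ k, homeoConj h.symm (restrict Ψ V k) ∈ topologicalFullGroup (restrict Φ U) := by
    intro k
    have : homeoConj h.symm (restrict Ψ V k) =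
        (q.symm ⟨_, apply_mem_topologicalFullGroup _ k⟩).1 := by
      ext1 x
      show h.symm (restrict Ψ V k (h x)) = _
      rw [Homeomorph.symm_apply_eq, hh, q.apply_symm_apply]
    rw [this]
    exact Subtype.property _
  obtain ⟨δ, hδ, hδk⟩ := (hΦeq.restrict U).exists_forall_ball h h1
  obtain ⟨η, hη, hηg⟩ := (hΨeq.restrict V).exists_forall_ball h.symm h2
  obtain ⟨x, hx⟩ := hU.1
  obtain ⟨A, hA, hxA, hAW⟩ := (hΦeq.restrict U).exists_isAdapted_subset
    (x := ⟨x, hx⟩) (W := Metric.ball ⟨x, hx⟩ δ ∩ h ⁻¹' Metric.ball (h ⟨x, hx⟩) η)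
    (Metric.isOpen_ball.inter (Metric.isOpen_ball.preimage h.continuous))
    ⟨Metric.mem_ball_self hδ, Metric.mem_ball_self hη⟩
  refine ReturnEquivalent.of_restrict hU hV (returnEquivalent_of_forall_eqOn h hA ?_ ?_)
  · intro g
    obtain ⟨k, hk⟩ := hδk g ⟨x, hx⟩
    exact ⟨k, fun a ha => hk a (hAW ha).1⟩
  · intro k
    obtain ⟨g, hg⟩ := hηg k (h ⟨x, hx⟩)
    refine ⟨g, fun a ha => ?_⟩
    have := hg (h a) (hAW ha).2
    rw [h.symm_apply_apply, Homeomorph.symm_apply_eq] at this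
    exact this.symm
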